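/- For each $n\ge 1$ let $X_{n,1},\dots,X_{n,n}$ be random variables with values in $\{0,1\}$, defined on a probability space that may depend on $n$, such that the finite sequence $X_{n,1},\dots,X_{n,n}$ is strictly stationary, i.e. $(X_{n,1},\dots,X_{n,m})$ and $(X_{n,1+h},\dots,X_{n,m+h})$ have the same law whenever $m+h\le n$. Put $S_r=S_{r,n}=X_{n,1}+\dots+X_{n,r}$ for $1\le r\le n$; in particular $S_n=X_{n,1}+\dots+X_{n,n}$. Let $\mathcal F_{a,b}$ be the $\sigma$-field generated by the $X_{n,i}$ with $a\le i\le b$, and define the mixing coefficient $$\alpha_n(l)=\sup|\mathbb P(A\cap B)-\mathbb P(A)\mathbb P(B)|,$$ where the supremum is over $m\ge 1$, $A\in\mathcal F_{1,m}$ with $\mathbb P(A)>0$, and $B\in\mathcal F_{m+l+1,n}$. Write $a_n\ll b_n$ (or $b_n\gg a_n$) for $a_n=o(b_n)$ as $n\to\infty$. Condition $\Delta$: $\alpha_n(l_n)\to 0$ for some sequence $\{l_n\}$ of natural numbers with $1\ll l_n\ll n$. Let $\mathcal R$ be the class of sequences $\{r_n\}$ of natural numbers such that, for some sequence $\{l_n\}$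 of natural numbers, $$n\gg r_n\gg l_n\gg 1,\qquad \frac{n}{r_n}\,\alpha_n^{2/3}(l_n)\to 0\quad(n\to\infty).\tag{7}$$ Let $\zeta_{r,n}$ be a random variable with the conditional distribution $\mathcal L(\zeta_{r,n})=\mathcal L(S_r\mid S_r>0)$, and let $\mathbf\Pi(\lambda)$ be the Poisson law with parameter $\lambda$. **Theorem 3.** Assume condition $\Delta$ and let $\lambda>0$. (a) If $S_n$ converges weakly to $\mathbf\Pi(\lambda)$ as $n\to\infty$, then for every sequence $\{r_n\}\in\mathcal R$ one has $\mathbb P(S_{r_n}>0)>0$ for all sufficiently large $n$ (so that $\zeta_{r_n,n}$ is defined), and $\zeta_{r_n,n}\to 1$ in probability. (b) Conversely, if $\mathbb P(X_{n,1}=\dots=X_{n,n}=0)\to e^{-\lambda}$ and $\zeta_{r_n,n}\to 1$ in probability for some sequence $\{r_n\}\in\mathcal R$, then $S_n$ converges weakly to $\mathbf\Pi(\lambda)$. -/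

import Mathlib

open MeasureTheory ProbabilityTheory Filter Asymptotics
open scoped Topology NNReal ENNReal

noncomputable section

namespace PoissonArray

/-- `Y 1, …, Y n` are 0-1 random variables on `(Ω, P)` and the finite sequence `Y 1, …, Y n` is
(strictly) stationary: `(Y 1, …, Y m)` and `(Y (1 + h), …, Y (m + h))` have the same joint law
whenever `m + h ≤ n`. Nothing is required of `Y k` for `k` outside `{1, …, n}`. -/
structure IsStationaryZeroOneRow {Ω : Type*} [MeasurableSpace Ω] (P : Measure Ω) (n : ℕ)
    (Y : ℕ → Ω → ℝ) : Prop where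
  measurable : ∀ k ∈ Finset.Icc 1 n, Measurable (Y k)
  zero_or_one : ∀ k ∈ Finset.Icc 1 n, ∀ ω, Y k ω = 0 ∨ Y k ω = 1
  stationary : ∀ m h : ℕ, m + h ≤ n →
    P.map (fun ω (i : Fin m) => Y (i + 1 + h) ω) = P.map (fun ω (i : Fin m) => Y (i + 1) ω)

/-- The σ-field generated by the variables `Y i`, `a ≤ i ≤ b` (trivial if `b < a`). -/
@[reducible] def sigmaField {Ω : Type*} (Y : ℕ → Ω → ℝ) (a b : ℕ) : MeasurableSpace Ω :=
  ⨆ i ∈ Finset.Icc a b, MeasurableSpace.comap (Y i) (borel ℝ)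

/-- The α-mixing coefficient `α_n(l)` of the row `Y 1, …, Y n`: the supremum of
`|P(A ∩ B) - P(A) P(B)|` over `m ≥ 1`, `A ∈ F_{1,m}` with `P(A) > 0`, and `B ∈ F_{m+l+1,n}`. -/
def alphaCoeff {Ω : Type*} [MeasurableSpace Ω] (P : Measure Ω) (Y : ℕ → Ω → ℝ) (n l : ℕ) : ℝ :=
  sSup {x : ℝ | ∃ m : ℕ, 1 ≤ m ∧ ∃ A B : Set Ω,
    MeasurableSet[sigmaField Y 1 m] A ∧ MeasurableSet[sigmaField Y (m + l + 1) n] B ∧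
      0 < P A ∧ x = |P.real (A ∩ B) - P.real A * P.real B|}

/-- `a_n ≪ b_n`, that is `a_n = o(b_n)` as `n → ∞`. -/
def MuchLess (a b : ℕ → ℕ) : Prop :=
  (fun n => (a n : ℝ)) =o[atTop] fun n => (b n : ℝ)

section Array

variable {Ω : ℕ → Type*} [∀ n, MeasurableSpace (Ω n)]

/-- The mixing condition `Δ`: `α_n(l_n) → 0` for some sequence `1 ≪ l_n ≪ n`. -/
def ConditionDelta (P : ∀ n, Measure (Ω n)) (X : ∀ n, ℕ → Ω n → ℝ) : Prop :=
  ∃ l : ℕ → ℕ, MuchLess (fun _ => 1) l ∧ MuchLess l (fun n => n) ∧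
    Tendsto (fun n => alphaCoeff (P n) (X n) n (l n)) atTop (𝓝 0)

/-- The class `R` of block lengths: sequences `r_n` such that, for some sequence `l_n`,
`n ≫ r_n ≫ l_n ≫ 1` and `(n / r_n) α_n(l_n)^{2/3} → 0`. -/
def classR (P : ∀ n, Measure (Ω n)) (X : ∀ n, ℕ → Ω n → ℝ) : Set (ℕ → ℕ) :=
  {r | ∃ l : ℕ → ℕ, MuchLess r (fun n => n) ∧ MuchLess l r ∧ MuchLess (fun _ => 1) l ∧
    Tendsto (fun n : ℕ => (n : ℝ) / (r n : ℝ) * alphaCoeff (P n) (X n) n (l n) ^ (2 / 3 : ℝ))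
      atTop (𝓝 0)}

end Array

/-- The partial sum `S_r = Y 1 + ⋯ + Y r`. -/
def partialSum {Ω : Type*} (Y : ℕ → Ω → ℝ) (r : ℕ) (ω : Ω) : ℝ :=
  ∑ k ∈ Finset.Icc 1 r, Y k ω

/-- The cluster size distribution `L(S_r | S_r > 0)`, as a measure on `ℝ`
(the zero measure if `P(S_r > 0) = 0`). -/
def clusterSizeLaw {Ω : Type*} [MeasurableSpace Ω] (P : Measure Ω) (Y : ℕ → Ω → ℝ) (r : ℕ) :
    Measure ℝ :=
  (ProbabilityTheory.cond P {ω | 0 < partialSum Y r ω}).map (partialSum Y r)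

/-- Random variables with laws `ν n` converge in probability to the constant `c`. -/
def LawsTendstoInProbability (ν : ℕ → Measure ℝ) (c : ℝ) : Prop :=
  ∀ ε : ℝ, 0 < ε → Tendsto (fun n => ν n {x | ε ≤ |x - c|}) atTop (𝓝 0)

end PoissonArray

end

/-!
The proof is Bernstein's blocking method, carried out with probability generating functions
`g_s(I) = E s ^ (number of ones in I)`, `0 ≤ s ≤ 1`, written as expectations of the products
`∏ (1 - (1 - s) X_k)`. Such a product is a convex combination of indicators of the events that all
`X_k`, `k ∈ T`, vanish, so its covariance over two index sets separated by a gap `l` is at most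
`α_n(l)` (`abs_pgf_union_sub_mul_le`), and deleting an index set `J` changes `g_s` by at most the
probability `1 - g_0(J)` of a one in `J`. For the block length `r`, the gap `l` and the number
`N = n / r` of blocks this yields
`|g_s(N r) - g_s(r) ^ N| ≤ N (α_n(l) + 2 P(S_l > 0))` (`abs_pgf_mul_sub_pow_le`).

Suppose that `P(S_n = 0)` has a positive limit. Then the number of separated blocks of length `b`
that fit into the row, times `P(S_b > 0)`, stays bounded (`eventually_mul_one_sub_pgf_le`). With
`b = r` this bounds `N P(S_r > 0)`. With `b = l` and `K` blocks inside each block of length `r`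
it gives `N P(S_l > 0) = O(1 / K)` for every `K`, so the error term above vanishes. Hence
`g_s(n) - exp (-N (1 - g_s(r))) → 0` (`tendsto_pgf_sub_exp`).

If `S_n` is asymptotically Poisson, the values `s = 0` and `s = 1 / 2` give `N P(S_r > 0) → λ` and
`N (1 - g_{1/2}(r)) → λ / 2`; by convexity of `k ↦ 2 ^ (-k)` this forces
`P(S_r ≥ 2) = o(P(S_r > 0))`. Conversely, if `P(S_r ≥ 2) = o(P(S_r > 0))`, then
`N (1 - g_s(r)) → λ (1 - s)` for all `s`, so the generating functions of `S_n` converge to that of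
the Poisson law, and so do the laws.
-/

namespace PoissonArray

/-! ### Generating functions over index sets -/

/-- The product `∏ (1 - (1 - s) Y k)` over `k ∈ I`. For 0-1 variables it equals `s` to the number
of ones among the `Y k`, `k ∈ I`; at `s = 0` it is the indicator of the event that all of them
vanish. The product form makes the factorization over disjoint index sets immediate. -/
noncomputable def thinProd {Ω : Type*} (s : ℝ) (Y : ℕ → Ω → ℝ) (I : Finset ℕ) (ω : Ω) : ℝ :=
  ∏ k ∈ I, (1 - (1 - s) * Y k ω)

/-- The probability generating function at `s` of the number of ones among the 0-1 variables `Y k`,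
`k ∈ I`. -/
noncomputable def pgf {Ω : Type*} [MeasurableSpace Ω] (P : Measure Ω) (Y : ℕ → Ω → ℝ) (s : ℝ)
    (I : Finset ℕ) : ℝ :=
  ∫ ω, thinProd s Y I ω ∂P

/-- The event that all the `Y k`, `k ∈ T`, vanish. -/
def zeroSet {Ω : Type*} (Y : ℕ → Ω → ℝ) (T : Finset ℕ) : Set Ω :=
  {ω | ∀ k ∈ T, Y k ω = 0}

section Row

set_option linter.unusedSectionVars false

variable {Ω : Type*} [mΩ : MeasurableSpace Ω] {P : Measure Ω} [IsProbabilityMeasure P] {n : ℕ}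
  {Y : ℕ → Ω → ℝ} {s : ℝ} {I J : Finset ℕ}

theorem IsStationaryZeroOneRow.factor_mem (hY : IsStationaryZeroOneRow P n Y)
    (hs : s ∈ Set.Icc (0 : ℝ) 1) {k : ℕ} (hk : k ∈ Finset.Icc 1 n) (ω : Ω) :
    1 - (1 - s) * Y k ω ∈ Set.Icc (0 : ℝ) 1 := by
  obtain ⟨h0, h1⟩ := hs
  rcases hY.zero_or_one k hk ω with h | h <;> rw [h] <;> constructor <;> linarith

theorem IsStationaryZeroOneRow.thinProd_mem (hY : IsStationaryZeroOneRow P n Y)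
    (hs : s ∈ Set.Icc (0 : ℝ) 1) (hI : I ⊆ Finset.Icc 1 n) (ω : Ω) :
    thinProd s Y I ω ∈ Set.Icc (0 : ℝ) 1 :=
  ⟨Finset.prod_nonneg fun _ hk => (hY.factor_mem hs (hI hk) ω).1,
    Finset.prod_le_one (fun _ hk => (hY.factor_mem hs (hI hk) ω).1)
      fun _ hk => (hY.factor_mem hs (hI hk) ω).2⟩

theorem IsStationaryZeroOneRow.measurable_thinProd (hY : IsStationaryZeroOneRow P n Y)
    (hI : I ⊆ Finset.Icc 1 n) : Measurable (thinProd s Y I) := by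
  unfold thinProd
  exact Finset.measurable_prod _ fun k hk => ((hY.measurable k (hI hk)).const_mul _).const_sub _

theorem IsStationaryZeroOneRow.integrable_thinProd (hY : IsStationaryZeroOneRow P n Y)
    (hs : s ∈ Set.Icc (0 : ℝ) 1) (hI : I ⊆ Finset.Icc 1 n) : Integrable (thinProd s Y I) P := by
  refine Integrable.of_bound (hY.measurable_thinProd hI).aestronglyMeasurable 1 (.of_forall ?_)
  intro ω
  have := hY.thinProd_mem hs hI ω
  rw [Real.norm_of_nonneg this.1]
  exact this.2

theorem IsStationaryZeroOneRow.pgf_nonneg (hY : IsStationaryZeroOneRow P n Y)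
    (hs : s ∈ Set.Icc (0 : ℝ) 1) (hI : I ⊆ Finset.Icc 1 n) : 0 ≤ pgf P Y s I :=
  integral_nonneg fun ω => (hY.thinProd_mem hs hI ω).1

theorem IsStationaryZeroOneRow.pgf_le_one (hY : IsStationaryZeroOneRow P n Y)
    (hs : s ∈ Set.Icc (0 : ℝ) 1) (hI : I ⊆ Finset.Icc 1 n) : pgf P Y s I ≤ 1 := by
  have := integral_mono (hY.integrable_thinProd hs hI) (integrable_const (1 : ℝ))
    fun ω => (hY.thinProd_mem hs hI ω).2
  simpa [pgf] using this

theorem thinProd_union (h : Disjoint I J) (ω : Ω) :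
    thinProd s Y (I ∪ J) ω = thinProd s Y I ω * thinProd s Y J ω :=
  Finset.prod_union h

theorem IsStationaryZeroOneRow.pgf_union_le (hY : IsStationaryZeroOneRow P n Y)
    (hs : s ∈ Set.Icc (0 : ℝ) 1) (hI : I ⊆ Finset.Icc 1 n) (hJ : J ⊆ Finset.Icc 1 n)
    (h : Disjoint I J) : pgf P Y s (I ∪ J) ≤ pgf P Y s I := by
  refine integral_mono (hY.integrable_thinProd hs (Finset.union_subset hI hJ))
    (hY.integrable_thinProd hs hI) fun ω => ?_
  simp only [thinProd_union h]
  exact mul_le_of_le_one_right (hY.thinProd_mem hs hI ω).1 (hY.thinProd_mem hs hJ ω).2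

theorem IsStationaryZeroOneRow.pgf_zero_le (hY : IsStationaryZeroOneRow P n Y)
    (hs : s ∈ Set.Icc (0 : ℝ) 1) (hI : I ⊆ Finset.Icc 1 n) : pgf P Y 0 I ≤ pgf P Y s I := by
  refine integral_mono (hY.integrable_thinProd (by simp) hI)
    (hY.integrable_thinProd hs hI) fun ω => ?_
  refine Finset.prod_le_prod (fun k hk => (hY.factor_mem (by simp) (hI hk) ω).1) fun k hk => ?_
  have := hs.1
  rcases hY.zero_or_one k (hI hk) ω with h | h <;> rw [h] <;> linarith

/-- Deleting the indices in `J` costs at most the probability that some `Y k`, `k ∈ J`, is one. -/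
theorem IsStationaryZeroOneRow.pgf_sub_le_union (hY : IsStationaryZeroOneRow P n Y)
    (hs : s ∈ Set.Icc (0 : ℝ) 1) (hI : I ⊆ Finset.Icc 1 n) (hJ : J ⊆ Finset.Icc 1 n)
    (h : Disjoint I J) : pgf P Y s I - (1 - pgf P Y 0 J) ≤ pgf P Y s (I ∪ J) := by
  have iI := hY.integrable_thinProd hs hI
  have iJ := hY.integrable_thinProd hs hJ
  have iU := hY.integrable_thinProd hs (Finset.union_subset hI hJ)
  have key : ∫ ω, (thinProd s Y I ω + thinProd s Y J ω - 1) ∂P ≤ pgf P Y s (I ∪ J) := by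
    refine integral_mono (((iI.add iJ).sub (integrable_const 1)) :) iU fun ω => ?_
    simp only [thinProd_union h]
    have h1 := hY.thinProd_mem hs hI ω
    have h2 := hY.thinProd_mem hs hJ ω
    nlinarith [mul_nonneg (sub_nonneg.2 h1.2) (sub_nonneg.2 h2.2)]
  have e : ∫ ω, (thinProd s Y I ω + thinProd s Y J ω - 1) ∂P =
      pgf P Y s I + pgf P Y s J - ∫ _, (1 : ℝ) ∂P :=
    (integral_sub (iI.add iJ) (integrable_const 1)).trans (by rw [integral_add' iI iJ]; rfl)
  rw [e] at key
  have h0 := hY.pgf_zero_le hs hJ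
  simp only [integral_const, probReal_univ, smul_eq_mul, mul_one] at key
  linarith

theorem IsStationaryZeroOneRow.pgf_shift (hY : IsStationaryZeroOneRow P n Y) {m h : ℕ}
    (hmh : m + h ≤ n) :
    pgf P Y s (Finset.Ioc h (h + m)) = pgf P Y s (Finset.Ioc 0 m) := by
  have key (h : ℕ) (hmh : m + h ≤ n) : pgf P Y s (Finset.Ioc h (h + m)) =
      ∫ v, ∏ i : Fin m, (1 - (1 - s) * v i)
        ∂(P.map (fun ω (i : Fin m) => Y (i + 1 + h) ω)) := by
    rw [integral_map]
    · refine integral_congr_ae (.of_forall fun ω => ?_)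
      simp only [thinProd]
      rw [Fin.prod_univ_eq_prod_range (fun i => 1 - (1 - s) * Y (i + 1 + h) ω)]
      refine (Finset.prod_nbij' (fun i => i + 1 + h) (fun k => k - 1 - h) ?_ ?_ ?_ ?_ ?_).symm <;>
        simp only [Finset.mem_range, Finset.mem_Ioc] <;> intros <;> first | omega | trivial
    · refine (measurable_pi_lambda _ fun i => hY.measurable _ ?_).aemeasurable
      have := i.2
      simp only [Finset.mem_Icc]
      omega
    · refine Measurable.aestronglyMeasurable ?_
      fun_prop
  rw [key h hmh, hY.stationary m h hmh]
  have := key 0 (by omega)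
  simp only [zero_add, add_zero] at this
  exact this.symm

/-! ### Mixing -/

theorem measurableSet_zeroSet {a b : ℕ} {T : Finset ℕ} (hT : T ⊆ Finset.Icc a b) :
    MeasurableSet[sigmaField Y a b] (zeroSet Y T) := by
  have : zeroSet Y T = ⋂ k ∈ T, Y k ⁻¹' {0} := by
    ext ω; simp [zeroSet]
  rw [this]
  refine Finset.measurableSet_biInter _ fun k hk => ?_
  have hle : MeasurableSpace.comap (Y k) (borel ℝ) ≤ sigmaField Y a b :=
    le_iSup₂_of_le (f := fun i (_ : i ∈ Finset.Icc a b) => MeasurableSpace.comap (Y i) (borel ℝ))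
      k (hT hk) le_rfl
  refine hle _ ⟨{0}, ?_, rfl⟩
  rw [← BorelSpace.measurable_eq (α := ℝ)]
  exact measurableSet_singleton 0

theorem abs_sub_le_one (A B : Set Ω) : |P.real (A ∩ B) - P.real A * P.real B| ≤ 1 := by
  have h1 : P.real (A ∩ B) ≤ 1 := measureReal_le_one
  have h2 : 0 ≤ P.real (A ∩ B) := measureReal_nonneg
  have h3 : P.real A * P.real B ≤ 1 :=
    mul_le_one₀ measureReal_le_one measureReal_nonneg measureReal_le_one
  have h4 : 0 ≤ P.real A * P.real B := mul_nonneg measureReal_nonneg measureReal_nonneg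
  rw [abs_le]; constructor <;> linarith

theorem alphaCoeff_mem (P : Measure Ω) [IsProbabilityMeasure P] (Y : ℕ → Ω → ℝ) (n l : ℕ) :
    alphaCoeff P Y n l ∈ Set.Icc (0 : ℝ) 1 := by
  constructor
  · refine Real.sSup_nonneg ?_
    rintro x ⟨m, -, A, B, -, -, -, rfl⟩
    positivity
  · refine Real.sSup_le ?_ zero_le_one
    rintro x ⟨m, -, A, B, -, -, -, rfl⟩
    exact abs_sub_le_one A B

theorem abs_zeroSet_le_alphaCoeff {m l : ℕ} (hm : 1 ≤ m) {T U : Finset ℕ}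
    (hT : T ⊆ Finset.Icc 1 m) (hU : U ⊆ Finset.Icc (m + l + 1) n) :
    |P.real (zeroSet Y T ∩ zeroSet Y U) - P.real (zeroSet Y T) * P.real (zeroSet Y U)|
      ≤ alphaCoeff P Y n l := by
  rcases eq_or_ne (P (zeroSet Y T)) 0 with h | h
  · have h1 : P.real (zeroSet Y T) = 0 := by simp [measureReal_def, h]
    have h2 : P.real (zeroSet Y T ∩ zeroSet Y U) = 0 := by
      simp [measureReal_def, measure_mono_null Set.inter_subset_left h]
    rw [h1, h2]
    simpa using (alphaCoeff_mem P Y n l).1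
  · refine le_csSup ⟨1, ?_⟩ ⟨m, hm, _, _, measurableSet_zeroSet hT, measurableSet_zeroSet hU,
      pos_iff_ne_zero.2 h, rfl⟩
    rintro x ⟨m, -, A, B, -, -, -, rfl⟩
    exact abs_sub_le_one A B

/-- The binomial-type weights of the expansion of `thinProd` over subsets; they are nonnegative and
add up to one. -/
def thinWeight (s : ℝ) (I T : Finset ℕ) : ℝ := s ^ (I \ T).card * (1 - s) ^ T.card

theorem thinWeight_nonneg (hs : s ∈ Set.Icc (0 : ℝ) 1) (I T : Finset ℕ) : 0 ≤ thinWeight s I T :=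
  mul_nonneg (pow_nonneg hs.1 _) (pow_nonneg (sub_nonneg.2 hs.2) _)

theorem sum_thinWeight (s : ℝ) (I : Finset ℕ) : ∑ T ∈ I.powerset, thinWeight s I T = 1 := by
  have := Finset.prod_add (fun _ : ℕ => 1 - s) (fun _ => s) I
  simp only [sub_add_cancel, Finset.prod_const, one_pow] at this
  rw [this]
  exact Finset.sum_congr rfl fun T _ => mul_comm _ _

/-- `thinProd` is a convex combination of indicators of the events `zeroSet Y T`. This reduces
covariances of such products to the events in the definition of the mixing coefficient. -/
theorem IsStationaryZeroOneRow.thinProd_eq_sum (hY : IsStationaryZeroOneRow P n Y)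
    (hI : I ⊆ Finset.Icc 1 n) (ω : Ω) :
    thinProd s Y I ω =
      ∑ T ∈ I.powerset, thinWeight s I T * (zeroSet Y T).indicator 1 ω := by
  have h1 : thinProd s Y I ω = ∏ k ∈ I, ((1 - s) * (1 - Y k ω) + s) :=
    Finset.prod_congr rfl fun k _ => by ring
  rw [h1, Finset.prod_add]
  refine Finset.sum_congr rfl fun T hT => ?_
  have h2 : ∏ k ∈ T, (1 - Y k ω) = (zeroSet Y T).indicator 1 ω := by
    by_cases h : ω ∈ zeroSet Y T
    · rw [Set.indicator_of_mem h]
      exact Finset.prod_eq_one fun k hk => by rw [h k hk, sub_zero]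
    · rw [Set.indicator_of_notMem h]
      simp only [zeroSet, Set.mem_ofPred_eq, not_forall] at h
      obtain ⟨k, hk, hk0⟩ := h
      refine Finset.prod_eq_zero hk ?_
      rw [(hY.zero_or_one k (hI (Finset.mem_powerset.1 hT hk)) ω).resolve_left hk0, sub_self]
  rw [Finset.prod_mul_distrib, h2, Finset.prod_const, Finset.prod_const, thinWeight]
  ring

theorem IsStationaryZeroOneRow.measurableSet_zeroSet (hY : IsStationaryZeroOneRow P n Y)
    {T : Finset ℕ} (hT : T ⊆ Finset.Icc 1 n) : MeasurableSet (zeroSet Y T) := by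
  have : zeroSet Y T = ⋂ k ∈ T, Y k ⁻¹' {0} := by
    ext ω; simp [zeroSet]
  rw [this]
  exact Finset.measurableSet_biInter _ fun k hk =>
    hY.measurable k (hT hk) (measurableSet_singleton 0)

theorem IsStationaryZeroOneRow.pgf_eq_sum (hY : IsStationaryZeroOneRow P n Y)
    (hI : I ⊆ Finset.Icc 1 n) :
    pgf P Y s I = ∑ T ∈ I.powerset, thinWeight s I T * P.real (zeroSet Y T) := by
  have hm (T) (hT : T ∈ I.powerset) :=
    hY.measurableSet_zeroSet ((Finset.mem_powerset.1 hT).trans hI)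
  simp only [pgf, hY.thinProd_eq_sum hI]
  rw [integral_finsetSum]
  · refine Finset.sum_congr rfl fun T hT => ?_
    rw [integral_const_mul, integral_indicator_one (hm T hT)]
  · exact fun T hT => ((integrable_const (1 : ℝ)).indicator (hm T hT)).const_mul _

theorem IsStationaryZeroOneRow.pgf_union_eq_sum (hY : IsStationaryZeroOneRow P n Y)
    (hI : I ⊆ Finset.Icc 1 n) (hJ : J ⊆ Finset.Icc 1 n) (h : Disjoint I J) :
    pgf P Y s (I ∪ J) = ∑ T ∈ I.powerset, ∑ U ∈ J.powerset,
      thinWeight s I T * thinWeight s J U * P.real (zeroSet Y T ∩ zeroSet Y U) := by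
  have hm (T) (hT : T ∈ I.powerset) :=
    hY.measurableSet_zeroSet ((Finset.mem_powerset.1 hT).trans hI)
  have hm' (T) (hT : T ∈ J.powerset) :=
    hY.measurableSet_zeroSet ((Finset.mem_powerset.1 hT).trans hJ)
  have e (ω : Ω) : thinProd s Y (I ∪ J) ω = ∑ T ∈ I.powerset, ∑ U ∈ J.powerset,
      thinWeight s I T * thinWeight s J U * (zeroSet Y T ∩ zeroSet Y U).indicator 1 ω := by
    rw [thinProd_union h, hY.thinProd_eq_sum hI, hY.thinProd_eq_sum hJ, Finset.sum_mul_sum]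
    refine Finset.sum_congr rfl fun T _ => Finset.sum_congr rfl fun U _ => ?_
    rw [Set.inter_indicator_one, Pi.mul_apply]
    ring
  simp only [pgf, e]
  have hi (T) (hT : T ∈ I.powerset) (U) (hU : U ∈ J.powerset) : Integrable (fun ω =>
      thinWeight s I T * thinWeight s J U *
        (zeroSet Y T ∩ zeroSet Y U).indicator (1 : Ω → ℝ) ω) P :=
    ((integrable_const (1 : ℝ)).indicator ((hm T hT).inter (hm' U hU))).const_mul _
  rw [integral_finsetSum _ fun T hT => integrable_finsetSum _ (hi T hT)]
  refine Finset.sum_congr rfl fun T hT => ?_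
  rw [integral_finsetSum _ (hi T hT)]
  refine Finset.sum_congr rfl fun U hU => ?_
  rw [integral_const_mul, integral_indicator_one ((hm T hT).inter (hm' U hU))]

/-- The generating function over two index sets separated by a gap of length `l` factorizes up to
the mixing coefficient. -/
theorem IsStationaryZeroOneRow.abs_pgf_union_sub_mul_le (hY : IsStationaryZeroOneRow P n Y)
    (hs : s ∈ Set.Icc (0 : ℝ) 1) {m l : ℕ} (hm : 1 ≤ m) (hmn : m ≤ n)
    (hI : I ⊆ Finset.Icc 1 m) (hJ : J ⊆ Finset.Icc (m + l + 1) n) :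
    |pgf P Y s (I ∪ J) - pgf P Y s I * pgf P Y s J| ≤ alphaCoeff P Y n l := by
  have hI' : I ⊆ Finset.Icc 1 n := hI.trans (Finset.Icc_subset_Icc_right hmn)
  have hJ' : J ⊆ Finset.Icc 1 n := hJ.trans (Finset.Icc_subset_Icc_left (by omega))
  have hd : Disjoint I J := by
    refine Finset.disjoint_left.2 fun k h1 h2 => ?_
    have := Finset.mem_Icc.1 (hI h1)
    have := Finset.mem_Icc.1 (hJ h2)
    omega
  rw [hY.pgf_union_eq_sum hI' hJ' hd, hY.pgf_eq_sum hI', hY.pgf_eq_sum hJ', Finset.sum_mul_sum,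
    ← Finset.sum_sub_distrib]
  simp only [← Finset.sum_sub_distrib]
  calc _ ≤ ∑ T ∈ I.powerset, ∑ U ∈ J.powerset,
        thinWeight s I T * thinWeight s J U * alphaCoeff P Y n l := by
        refine (Finset.abs_sum_le_sum_abs _ _).trans (Finset.sum_le_sum fun T hT => ?_)
        refine (Finset.abs_sum_le_sum_abs _ _).trans (Finset.sum_le_sum fun U hU => ?_)
        have hw : 0 ≤ thinWeight s I T * thinWeight s J U :=
          mul_nonneg (thinWeight_nonneg hs _ _) (thinWeight_nonneg hs _ _)
        have := abs_zeroSet_le_alphaCoeff (P := P) (Y := Y) hm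
          ((Finset.mem_powerset.1 hT).trans hI) ((Finset.mem_powerset.1 hU).trans hJ)
        calc _ = |thinWeight s I T * thinWeight s J U * (P.real (zeroSet Y T ∩ zeroSet Y U)
                - P.real (zeroSet Y T) * P.real (zeroSet Y U))| := by congr 1; ring
          _ ≤ _ := by
            rw [abs_mul, abs_of_nonneg hw]
            exact mul_le_mul_of_nonneg_left this hw
    _ = alphaCoeff P Y n l := by
        simp_rw [← Finset.sum_mul, ← Finset.mul_sum, sum_thinWeight, mul_one]
        rw [sum_thinWeight, one_mul]

/-! ### Bernstein blocks -/

theorem Ioc_subset_Icc_one {a b : ℕ} (h : b ≤ n) : Finset.Ioc a b ⊆ Finset.Icc 1 n := by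
  intro k hk
  simp only [Finset.mem_Ioc, Finset.mem_Icc] at hk ⊢
  omega

theorem Ioc_disjoint {a b c d : ℕ} (h : b ≤ c) : Disjoint (Finset.Ioc a b) (Finset.Ioc c d) := by
  refine Finset.disjoint_left.2 fun k h1 h2 => ?_
  simp only [Finset.mem_Ioc] at h1 h2
  omega

theorem IsStationaryZeroOneRow.pgf_anti (hY : IsStationaryZeroOneRow P n Y)
    (hs : s ∈ Set.Icc (0 : ℝ) 1) (hJ : J ⊆ Finset.Icc 1 n) (h : I ⊆ J) :
    pgf P Y s J ≤ pgf P Y s I := by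
  have := hY.pgf_union_le hs (h.trans hJ) ((Finset.sdiff_subset (t := I)).trans hJ)
    Finset.disjoint_sdiff
  rwa [Finset.union_sdiff_of_subset h] at this

/-- Two adjacent blocks `(0, m]` and `(m, m + b]`: the second costs at most the probability that it
contains a one. -/
theorem IsStationaryZeroOneRow.pgf_sub_le_add (hY : IsStationaryZeroOneRow P n Y)
    (hs : s ∈ Set.Icc (0 : ℝ) 1) {m b : ℕ} (h : m + b ≤ n) :
    pgf P Y s (Finset.Ioc 0 m) - (1 - pgf P Y 0 (Finset.Ioc 0 b))
      ≤ pgf P Y s (Finset.Ioc 0 (m + b)) := by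
  have := hY.pgf_sub_le_union hs (Ioc_subset_Icc_one (a := 0) (b := m) (by omega))
    (Ioc_subset_Icc_one (a := m) (b := m + b) h) (Ioc_disjoint le_rfl)
  rwa [hY.pgf_shift (by omega), Finset.Ioc_union_Ioc_eq_Ioc (by omega) (by omega)] at this

/-- Factorization of separated blocks `(0, m]` and `(m + l, m + l + b]`. -/
theorem IsStationaryZeroOneRow.abs_pgf_gap_le (hY : IsStationaryZeroOneRow P n Y)
    (hs : s ∈ Set.Icc (0 : ℝ) 1) {m l b : ℕ} (hm : 1 ≤ m) (h : m + l + b ≤ n) :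
    |pgf P Y s (Finset.Ioc 0 m ∪ Finset.Ioc (m + l) (m + l + b))
      - pgf P Y s (Finset.Ioc 0 m) * pgf P Y s (Finset.Ioc 0 b)| ≤ alphaCoeff P Y n l := by
  have := hY.abs_pgf_union_sub_mul_le hs (l := l) hm (by omega)
    (I := Finset.Ioc 0 m) (J := Finset.Ioc (m + l) (m + l + b)) (Ioc_subset_Icc_one le_rfl)
    (fun k hk => by simp only [Finset.mem_Ioc, Finset.mem_Icc] at hk ⊢; omega)
  rwa [hY.pgf_shift (by omega)] at this

theorem pgf_empty : pgf P Y s ∅ = 1 := by simp [pgf, thinProd]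

/-- Up to the mixing error, the generating function of `M` periods of length `d` is at most the
`M`-th power of that of a block of length `b ≤ d - l`. -/
theorem IsStationaryZeroOneRow.pgf_mul_le_pow (hY : IsStationaryZeroOneRow P n Y)
    (hs : s ∈ Set.Icc (0 : ℝ) 1) {b l d : ℕ} (hd : l + b ≤ d) (M : ℕ) (hM : M * d ≤ n) :
    pgf P Y s (Finset.Ioc 0 (M * d)) ≤
      pgf P Y s (Finset.Ioc 0 b) ^ M + M * alphaCoeff P Y n l := by
  induction M with
  | zero => simp [pgf_empty]
  | succ M ih =>
    rw [add_mul, one_mul] at hM ⊢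
    have ih := ih (by omega)
    have hα := (alphaCoeff_mem P Y n l).1
    have hb0 := hY.pgf_nonneg hs (Ioc_subset_Icc_one (a := 0) (b := b) (by omega))
    have hb1 := hY.pgf_le_one hs (Ioc_subset_Icc_one (a := 0) (b := b) (by omega))
    have step : pgf P Y s (Finset.Ioc 0 (M * d + d)) ≤
        pgf P Y s (Finset.Ioc 0 (M * d)) * pgf P Y s (Finset.Ioc 0 b) + alphaCoeff P Y n l := by
      rcases Nat.eq_zero_or_pos (M * d) with h0 | h0
      · rw [h0, Finset.Ioc_self, pgf_empty, zero_add, one_mul]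
        have := hY.pgf_anti hs (Ioc_subset_Icc_one (a := 0) (b := d) (by omega))
          (Finset.Ioc_subset_Ioc_right (show b ≤ d by omega))
        linarith
      · have h1 := (abs_le.1 (hY.abs_pgf_gap_le hs (l := l) (b := b) h0 (by omega))).2
        have h2 := hY.pgf_anti hs (Ioc_subset_Icc_one (a := 0) (b := M * d + d) hM)
          (I := Finset.Ioc 0 (M * d) ∪ Finset.Ioc (M * d + l) (M * d + l + b))
          (fun k hk => by simp only [Finset.mem_union, Finset.mem_Ioc] at hk ⊢; omega)
        linarith
    have h3 := mul_le_mul_of_nonneg_right ih hb0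
    have h4 : M * alphaCoeff P Y n l * pgf P Y s (Finset.Ioc 0 b) ≤ M * alphaCoeff P Y n l :=
      mul_le_of_le_one_right (by positivity) hb1
    push_cast
    rw [pow_succ]
    linarith

/-- The generating function of `M` adjacent blocks of length `r` is the `M`-th power of that of one
block, up to `M` times the mixing error and the cost of clearing a gap of length `l` twice: once to
separate a block from its predecessors and once to restore its full length. -/
theorem IsStationaryZeroOneRow.abs_pgf_mul_sub_pow_le (hY : IsStationaryZeroOneRow P n Y)
    (hs : s ∈ Set.Icc (0 : ℝ) 1) {l r : ℕ} (hlr : l ≤ r) (M : ℕ) (hM : M * r ≤ n) :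
    |pgf P Y s (Finset.Ioc 0 (M * r)) - pgf P Y s (Finset.Ioc 0 r) ^ M| ≤
      M * (alphaCoeff P Y n l + 2 * (1 - pgf P Y 0 (Finset.Ioc 0 l))) := by
  induction M with
  | zero => simp [pgf_empty]
  | succ M ih =>
    rw [add_mul, one_mul] at hM ⊢
    have ih := ih (by omega)
    have hα := (alphaCoeff_mem P Y n l).1
    have hl : pgf P Y 0 (Finset.Ioc 0 l) ≤ 1 :=
      hY.pgf_le_one (by simp) (Ioc_subset_Icc_one (by omega))
    have hb0 := hY.pgf_nonneg hs (Ioc_subset_Icc_one (a := 0) (b := r) (by omega))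
    have hb1 := hY.pgf_le_one hs (Ioc_subset_Icc_one (a := 0) (b := r) (by omega))
    have step : |pgf P Y s (Finset.Ioc 0 (M * r + r)) -
        pgf P Y s (Finset.Ioc 0 (M * r)) * pgf P Y s (Finset.Ioc 0 r)| ≤
        alphaCoeff P Y n l + 2 * (1 - pgf P Y 0 (Finset.Ioc 0 l)) := by
      rcases Nat.eq_zero_or_pos (M * r) with h0 | h0
      · rw [h0, Finset.Ioc_self, pgf_empty, zero_add, one_mul, sub_self, abs_zero]
        linarith
      · obtain ⟨b, rfl⟩ := Nat.exists_eq_add_of_le hlr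
        have h1 := abs_le.1 (hY.abs_pgf_gap_le hs (l := l) (b := b) h0 (by omega))
        have e : (Finset.Ioc 0 (M * (l + b)) ∪
            Finset.Ioc (M * (l + b) + l) (M * (l + b) + l + b)) ∪
            Finset.Ioc (M * (l + b)) (M * (l + b) + l) =
            Finset.Ioc 0 (M * (l + b) + (l + b)) := by
          ext k
          simp only [Finset.mem_union, Finset.mem_Ioc]
          omega
        have dj : Disjoint (Finset.Ioc 0 (M * (l + b)) ∪
            Finset.Ioc (M * (l + b) + l) (M * (l + b) + l + b))
            (Finset.Ioc (M * (l + b)) (M * (l + b) + l)) :=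
          Finset.disjoint_union_left.2 ⟨Ioc_disjoint le_rfl, (Ioc_disjoint le_rfl).symm⟩
        have sI := Finset.union_subset
          (Ioc_subset_Icc_one (n := n) (a := 0) (b := M * (l + b)) (by omega))
          (Ioc_subset_Icc_one (n := n) (a := M * (l + b) + l) (b := M * (l + b) + l + b) (by omega))
        have sJ := Ioc_subset_Icc_one (n := n) (a := M * (l + b)) (b := M * (l + b) + l) (by omega)
        have h2 := hY.pgf_sub_le_union hs sI sJ dj
        have h3 := hY.pgf_union_le hs sI sJ dj
        rw [e] at h2 h3
        rw [hY.pgf_shift (by omega)] at h2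
        have h4 := hY.pgf_sub_le_add hs (m := b) (b := l) (by omega)
        have h5 := hY.pgf_anti hs (Ioc_subset_Icc_one (a := 0) (b := b + l) (by omega))
          (Finset.Ioc_subset_Ioc_right (show b ≤ b + l by omega))
        rw [add_comm b l] at h4 h5
        have g0 := hY.pgf_nonneg hs
          (Ioc_subset_Icc_one (a := 0) (b := M * (l + b)) (by omega))
        have g1 := hY.pgf_le_one hs
          (Ioc_subset_Icc_one (a := 0) (b := M * (l + b)) (by omega))
        have h6 := mul_le_mul_of_nonneg_left h5 g0
        have h7 := mul_le_mul_of_nonneg_left h4 g0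
        have h8 : pgf P Y s (Finset.Ioc 0 (M * (l + b))) * (1 - pgf P Y 0 (Finset.Ioc 0 l)) ≤
            1 - pgf P Y 0 (Finset.Ioc 0 l) := mul_le_of_le_one_left (by linarith) g1
        rw [abs_le]
        constructor <;> linarith
    calc _ = |(pgf P Y s (Finset.Ioc 0 (M * r + r)) -
          pgf P Y s (Finset.Ioc 0 (M * r)) * pgf P Y s (Finset.Ioc 0 r)) +
          (pgf P Y s (Finset.Ioc 0 (M * r)) - pgf P Y s (Finset.Ioc 0 r) ^ M) *
            pgf P Y s (Finset.Ioc 0 r)| := by congr 1; ring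
      _ ≤ _ + _ := abs_add_le _ _
      _ ≤ (alphaCoeff P Y n l + 2 * (1 - pgf P Y 0 (Finset.Ioc 0 l))) +
          M * (alphaCoeff P Y n l + 2 * (1 - pgf P Y 0 (Finset.Ioc 0 l))) := by
        refine add_le_add step ?_
        rw [abs_mul, abs_of_nonneg hb0]
        exact (mul_le_of_le_one_right (abs_nonneg _) hb1).trans ih
      _ = _ := by push_cast; ring

/-- A remainder `(m, n]` of length at most `r` costs at most the probability of a one in a block
of length `r`. -/
theorem IsStationaryZeroOneRow.abs_pgf_sub_le_tail (hY : IsStationaryZeroOneRow P n Y)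
    (hs : s ∈ Set.Icc (0 : ℝ) 1) {m r : ℕ} (hm : m ≤ n) (hr : n - m ≤ r) (hrn : r ≤ n) :
    |pgf P Y s (Finset.Ioc 0 n) - pgf P Y s (Finset.Ioc 0 m)| ≤
      1 - pgf P Y 0 (Finset.Ioc 0 r) := by
  have h1 := hY.pgf_sub_le_add hs (m := m) (b := n - m) (by omega)
  have h2 := hY.pgf_anti (s := 0) (by simp) (Ioc_subset_Icc_one (a := 0) (b := r) hrn)
    (Finset.Ioc_subset_Ioc_right hr)
  have h3 := hY.pgf_anti hs (Ioc_subset_Icc_one (a := 0) (b := n) le_rfl)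
    (Finset.Ioc_subset_Ioc_right hm)
  rw [Nat.add_sub_cancel' hm] at h1
  rw [abs_le]
  constructor <;> linarith

end Row

/-! ### Asymptotics of the generating functions -/

/-- `(1 - x) ^ N` and `exp (-N x)` are asymptotically equal as long as `N x` stays bounded and
`x → 0`: they differ by at most `N x ^ 2`. -/
theorem tendsto_one_sub_pow_sub_exp {x : ℕ → ℝ} {N : ℕ → ℕ} {C : ℝ}
    (h01 : ∀ᶠ n in atTop, x n ∈ Set.Icc (0 : ℝ) 1) (hx : Tendsto x atTop (𝓝 0))
    (hb : ∀ᶠ n in atTop, N n * x n ≤ C) :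
    Tendsto (fun n => (1 - x n) ^ N n - Real.exp (-(N n * x n))) atTop (𝓝 0) := by
  have hlim : Tendsto (fun n => C * x n) atTop (𝓝 0) := by simpa using hx.const_mul C
  refine squeeze_zero_norm' ?_ hlim
  filter_upwards [h01, hb] with n h hC
  have e : Real.exp (-(N n * x n)) = Real.exp (-x n) ^ N n := by
    rw [← Real.exp_nat_mul]; ring_nf
  have h1 : |1 - x n| ≤ 1 := by rw [abs_le]; constructor <;> linarith [h.1, h.2]
  have h2 : |Real.exp (-x n)| ≤ 1 := by
    rw [abs_of_pos (Real.exp_pos _)]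
    exact Real.exp_le_one_iff.2 (by linarith [h.1])
  have h3 : |1 - x n - Real.exp (-x n)| ≤ x n ^ 2 := by
    have := Real.abs_exp_sub_one_sub_id_le (x := -x n)
      (by rw [abs_neg, abs_of_nonneg h.1]; exact h.2)
    rw [neg_sq] at this
    rw [abs_sub_comm]
    convert this using 2
    ring
  rw [e, Real.norm_eq_abs]
  calc _ ≤ |1 - x n - Real.exp (-x n)| * N n * max |1 - x n| |Real.exp (-x n)| ^ (N n - 1) :=
        abs_pow_sub_pow_le _ _ _
    _ ≤ x n ^ 2 * N n * 1 := by
        gcongr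
        exact pow_le_one₀ (by positivity) (max_le h1 h2)
    _ = N n * x n * x n := by ring
    _ ≤ C * x n := mul_le_mul_of_nonneg_right hC h.1

section Array

variable {Ω : ℕ → Type*} [∀ n, MeasurableSpace (Ω n)] {P : ∀ n, Measure (Ω n)}
  [∀ n, IsProbabilityMeasure (P n)] {X : ∀ n, ℕ → Ω n → ℝ} {r l : ℕ → ℕ}

theorem MuchLess.eventually_mul_le {a b : ℕ → ℕ} (h : MuchLess a b) (K : ℕ) :
    ∀ᶠ n in atTop, K * a n ≤ b n := by
  filter_upwards [h.bound (show (0 : ℝ) < 1 / (K + 1) by positivity)] with n hn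
  simp only [Real.norm_natCast] at hn
  rw [div_mul_eq_mul_div, one_mul, le_div_iff₀ (by positivity)] at hn
  have : (K : ℝ) * a n ≤ b n := by nlinarith [Nat.cast_nonneg (α := ℝ) (a n)]
  exact_mod_cast this

/-- The consequences of membership in the class of block lengths that the blocking argument uses.
Since `α ≤ 1`, the rate condition with `α ^ (2 / 3)` implies the one with `α`. -/
theorem exists_gap_of_mem_classR (hr : r ∈ classR P X) : ∃ l : ℕ → ℕ,
    (∀ K : ℕ, ∀ᶠ n in atTop, K * l n ≤ r n) ∧ (∀ K : ℕ, ∀ᶠ n in atTop, K * r n ≤ n) ∧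
    (∀ᶠ n in atTop, 0 < r n) ∧
    Tendsto (fun n => ((n / r n : ℕ) : ℝ) * alphaCoeff (P n) (X n) n (l n)) atTop (𝓝 0) := by
  obtain ⟨l, hrn, hlr, hl, hα⟩ := hr
  refine ⟨l, hlr.eventually_mul_le, hrn.eventually_mul_le, ?_, ?_⟩
  · filter_upwards [hl.eventually_mul_le 1, hlr.eventually_mul_le 1] with n h1 h2
    omega
  · refine squeeze_zero (fun n => ?_) (fun n => ?_) hα
    · exact mul_nonneg (Nat.cast_nonneg _) (alphaCoeff_mem _ _ _ _).1
    · have h := alphaCoeff_mem (P n) (X n) n (l n)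
      exact mul_le_mul Nat.cast_div_le (Real.self_le_rpow_of_le_one h.1 h.2 (by norm_num)) h.1
        (by positivity)

/-- If `P(S_n = 0)` stays away from zero, then the probability of a one in a block of length `b`
is `O(1 / M)` as soon as `M` such blocks, separated by gaps of length `l`, fit into the row. -/
theorem eventually_mul_one_sub_pgf_le
    (hX : ∀ n, IsStationaryZeroOneRow (P n) n (X n)) {c : ℝ}
    (h0 : Tendsto (fun n => pgf (P n) (X n) 0 (Finset.Ioc 0 n)) atTop (𝓝 (Real.exp (-c))))
    {b d M : ℕ → ℕ} (hb : ∀ᶠ n in atTop, 0 < M n → l n + b n ≤ d n)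
    (hM : ∀ᶠ n in atTop, M n * d n ≤ n)
    (hα : Tendsto (fun n => (M n : ℝ) * alphaCoeff (P n) (X n) n (l n)) atTop (𝓝 0)) :
    ∀ᶠ n in atTop, M n * (1 - pgf (P n) (X n) 0 (Finset.Ioc 0 (b n))) ≤ c + 1 := by
  have hlim := h0.sub hα
  rw [sub_zero] at hlim
  have hlt : Real.exp (-(c + 1)) < Real.exp (-c) := Real.exp_lt_exp.2 (by linarith)
  have hc : 0 ≤ c + 1 := by
    have : Real.exp (-c) ≤ 1 := le_of_tendsto h0 (.of_forall fun n =>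
      (hX n).pgf_le_one (by simp) (Ioc_subset_Icc_one le_rfl))
    have := Real.exp_le_one_iff.1 this
    linarith
  filter_upwards [hb, hM, hlim.eventually (lt_mem_nhds hlt)] with n h1 h2 h3
  rcases Nat.eq_zero_or_pos (M n) with hz | hz
  · simpa [hz] using hc
  have h1 := h1 hz
  have hbn : b n ≤ n := by nlinarith
  set p := pgf (P n) (X n) 0 (Finset.Ioc 0 (b n)) with hp
  have hp0 : 0 ≤ p := (hX n).pgf_nonneg (by simp) (Ioc_subset_Icc_one hbn)
  have h5 := (hX n).pgf_mul_le_pow (s := 0) (by simp) h1 (M n) h2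
  have h6 := (hX n).pgf_anti (s := 0) (by simp) (Ioc_subset_Icc_one (a := 0) (b := n) le_rfl)
    (Finset.Ioc_subset_Ioc_right h2)
  have h7 : p ^ M n ≤ Real.exp (-(M n * (1 - p))) := by
    have : p ≤ Real.exp (-(1 - p)) := by linarith [Real.add_one_le_exp (-(1 - p))]
    calc p ^ M n ≤ Real.exp (-(1 - p)) ^ M n := pow_le_pow_left₀ hp0 this _
      _ = _ := by rw [← Real.exp_nat_mul]; ring_nf
  have h8 : Real.exp (-(c + 1)) < Real.exp (-(M n * (1 - p))) := by linarith
  have := Real.exp_lt_exp.1 h8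
  linarith

theorem tendsto_blockCount (hr0 : ∀ᶠ n in atTop, 0 < r n)
    (hrn : ∀ K : ℕ, ∀ᶠ n in atTop, K * r n ≤ n) : Tendsto (fun n => n / r n) atTop atTop := by
  refine tendsto_atTop.2 fun K => ?_
  filter_upwards [hr0, hrn K] with n h1 h2
  exact (Nat.le_div_iff_mul_le h1).2 h2

/-- The blocking approximation: if `P(S_n = 0)` has a positive limit, then the generating function
of `S_n` is asymptotically that of a compound Poisson law whose clusters are distributed as `S_r`,
with one potential cluster in each of the `n / r` blocks. -/
theorem tendsto_pgf_sub_exp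
    (hX : ∀ n, IsStationaryZeroOneRow (P n) n (X n)) {c : ℝ}
    (h0 : Tendsto (fun n => pgf (P n) (X n) 0 (Finset.Ioc 0 n)) atTop (𝓝 (Real.exp (-c))))
    (hr : r ∈ classR P X) {s : ℝ} (hs : s ∈ Set.Icc (0 : ℝ) 1) :
    Tendsto (fun n => pgf (P n) (X n) s (Finset.Ioc 0 n) -
      Real.exp (-((n / r n : ℕ) * (1 - pgf (P n) (X n) s (Finset.Ioc 0 (r n)))))) atTop (𝓝 0) := by
  obtain ⟨l, hlr, hrn, hr0, hα⟩ := exists_gap_of_mem_classR hr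
  have hN := tendsto_blockCount hr0 hrn
  set N : ℕ → ℕ := fun n => n / r n with hNdef
  have hle (n : ℕ) : N n * r n ≤ n := Nat.div_mul_le_self n (r n)
  have hrn1 := hrn 1
  have hlr1 := hlr 1
  -- A block of length `r` contains a one with probability `O(1 / N)`: use every other block,
  -- so that the gaps have length `r ≥ l`.
  have hq : ∀ᶠ n in atTop,
      N n * (1 - pgf (P n) (X n) 0 (Finset.Ioc 0 (r n))) ≤ 2 * (c + 1) + 1 := by
    have h := eventually_mul_one_sub_pgf_le hX h0 (l := l) (b := r) (d := fun n => 2 * r n)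
      (M := fun n => N n / 2) (by filter_upwards [hlr1] with n h _; omega)
      (.of_forall fun n => by
        calc N n / 2 * (2 * r n) = N n / 2 * 2 * r n := by ring
          _ ≤ N n * r n := Nat.mul_le_mul_right _ (Nat.div_mul_le_self _ _)
          _ ≤ n := hle n)
      (squeeze_zero (fun n => mul_nonneg (Nat.cast_nonneg _) (alphaCoeff_mem _ _ _ _).1)
        (fun n => mul_le_mul_of_nonneg_right (Nat.cast_le.2 (Nat.div_le_self _ _))
          (alphaCoeff_mem _ _ _ _).1) hα)
    filter_upwards [h, hrn1] with n h h1
    have hq0 := (hX n).pgf_nonneg (s := 0) (by simp) (Ioc_subset_Icc_one (a := 0) (b := r n)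
      (by omega))
    have hq1 := (hX n).pgf_le_one (s := 0) (by simp) (Ioc_subset_Icc_one (a := 0) (b := r n)
      (by omega))
    have h2 : (N n : ℝ) ≤ 2 * (N n / 2 : ℕ) + 1 := by
      have : N n ≤ 2 * (N n / 2) + 1 := by omega
      exact_mod_cast this
    nlinarith
  have hqlim : Tendsto (fun n => 1 - pgf (P n) (X n) 0 (Finset.Ioc 0 (r n))) atTop (𝓝 0) := by
    have hN' : Tendsto (fun n => (2 * (c + 1) + 1) / (N n : ℝ)) atTop (𝓝 0) :=
      (tendsto_natCast_atTop_atTop.comp hN).const_div_atTop _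
    refine squeeze_zero' ?_ ?_ hN'
    · filter_upwards [hrn1] with n h1
      exact sub_nonneg.2 ((hX n).pgf_le_one (by simp) (Ioc_subset_Icc_one (by omega)))
    · filter_upwards [hq, hN.eventually_gt_atTop 0] with n h1 h2
      rw [le_div_iff₀ (by exact_mod_cast h2)]
      linarith
  -- Gaps of length `l` are negligible even in total, because `K` of them, suitably separated,
  -- fit into each block of length `r`, for every fixed `K`.
  have hu : Tendsto (fun n => N n * (1 - pgf (P n) (X n) 0 (Finset.Ioc 0 (l n)))) atTop (𝓝 0) := by
    have hnn : ∀ᶠ n in atTop, 0 ≤ N n * (1 - pgf (P n) (X n) 0 (Finset.Ioc 0 (l n))) := by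
      filter_upwards [hrn1, hlr1] with n h1 h2
      exact mul_nonneg (Nat.cast_nonneg _)
        (sub_nonneg.2 ((hX n).pgf_le_one (by simp) (Ioc_subset_Icc_one (by omega))))
    refine tendsto_order.2 ⟨fun a ha => hnn.mono fun n h => ha.trans_le h, fun ε hε => ?_⟩
    obtain ⟨K, hK⟩ := exists_nat_gt ((c + 1) / ε)
    have h := eventually_mul_one_sub_pgf_le hX h0 (l := l) (b := l) (d := fun n => 2 * l n)
      (M := fun n => (K + 1) * N n) (.of_forall fun n _ => by omega)
      (by
        filter_upwards [hlr (2 * (K + 1))] with n h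
        calc (K + 1) * N n * (2 * l n) = N n * (2 * (K + 1) * l n) := by ring
          _ ≤ N n * r n := Nat.mul_le_mul_left _ h
          _ ≤ n := hle n)
      (by simpa [mul_assoc] using hα.const_mul ((K : ℝ) + 1))
    filter_upwards [h] with n h
    push_cast at h
    rw [div_lt_iff₀ hε] at hK
    by_contra! hcon
    have : ((K : ℝ) + 1) * ε ≤ (K + 1) * (N n * (1 - pgf (P n) (X n) 0 (Finset.Ioc 0 (l n)))) :=
      mul_le_mul_of_nonneg_left hcon (by positivity)
    nlinarith
  have herr : Tendsto (fun n => (1 - pgf (P n) (X n) 0 (Finset.Ioc 0 (r n))) +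
      (N n * alphaCoeff (P n) (X n) n (l n) +
        2 * (N n * (1 - pgf (P n) (X n) 0 (Finset.Ioc 0 (l n)))))) atTop (𝓝 0) := by
    simpa using hqlim.add (hα.add (hu.const_mul 2))
  have hpow : Tendsto (fun n => pgf (P n) (X n) s (Finset.Ioc 0 n) -
      pgf (P n) (X n) s (Finset.Ioc 0 (r n)) ^ N n) atTop (𝓝 0) := by
    refine squeeze_zero_norm' ?_ herr
    filter_upwards [hrn1, hlr1, hr0] with n h1 h2 h3
    have t1 := (hX n).abs_pgf_mul_sub_pow_le hs (l := l n) (r := r n) (by omega) (N n) (hle n)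
    have t2 := (hX n).abs_pgf_sub_le_tail hs (r := r n) (hle n)
      (by
        have := Nat.div_add_mod' n (r n)
        have := Nat.mod_lt n h3
        simp only [hNdef]
        omega) (by omega)
    calc _ = |(pgf (P n) (X n) s (Finset.Ioc 0 n) - pgf (P n) (X n) s (Finset.Ioc 0 (N n * r n))) +
          (pgf (P n) (X n) s (Finset.Ioc 0 (N n * r n)) -
            pgf (P n) (X n) s (Finset.Ioc 0 (r n)) ^ N n)| := by
          rw [Real.norm_eq_abs]; congr 1; ring
      _ ≤ _ := abs_add_le _ _
      _ ≤ _ := by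
        refine (add_le_add t2 t1).trans (le_of_eq ?_)
        ring
  have hxle : ∀ᶠ n in atTop, 0 ≤ 1 - pgf (P n) (X n) s (Finset.Ioc 0 (r n)) ∧
      1 - pgf (P n) (X n) s (Finset.Ioc 0 (r n)) ≤ 1 - pgf (P n) (X n) 0 (Finset.Ioc 0 (r n)) ∧
      1 - pgf (P n) (X n) 0 (Finset.Ioc 0 (r n)) ≤ 1 := by
    filter_upwards [hrn1] with n h1
    have hsub := Ioc_subset_Icc_one (a := 0) (b := r n) (n := n) (by omega)
    exact ⟨sub_nonneg.2 ((hX n).pgf_le_one hs hsub),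
      sub_le_sub_left ((hX n).pgf_zero_le hs hsub) _,
      sub_le_self _ ((hX n).pgf_nonneg (by simp) hsub)⟩
  have hexp := tendsto_one_sub_pow_sub_exp (N := N) (C := 2 * (c + 1) + 1)
    (x := fun n => 1 - pgf (P n) (X n) s (Finset.Ioc 0 (r n)))
    (hxle.mono fun n h => ⟨h.1, h.2.1.trans h.2.2⟩)
    (squeeze_zero' (hxle.mono fun n h => h.1) (hxle.mono fun n h => h.2.1) hqlim)
    (by
      filter_upwards [hxle, hq] with n h h'
      exact (mul_le_mul_of_nonneg_left h.2.1 (Nat.cast_nonneg _)).trans h')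
  have := hpow.add hexp
  simp only [sub_sub_cancel, add_zero, sub_add_sub_cancel] at this
  exact this

/-- If the generating function of `S_n` at `s` tends to `exp (-c')`, then `N (1 - g) → c'`, where
`N = n / r` is the number of blocks and `g` the generating function of one block at `s`. -/
theorem tendsto_mul_one_sub_pgf
    (hX : ∀ n, IsStationaryZeroOneRow (P n) n (X n)) {c c' : ℝ}
    (h0 : Tendsto (fun n => pgf (P n) (X n) 0 (Finset.Ioc 0 n)) atTop (𝓝 (Real.exp (-c))))
    (hr : r ∈ classR P X) {s : ℝ} (hs : s ∈ Set.Icc (0 : ℝ) 1)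
    (h : Tendsto (fun n => pgf (P n) (X n) s (Finset.Ioc 0 n)) atTop (𝓝 (Real.exp (-c')))) :
    Tendsto (fun n => ((n / r n : ℕ) : ℝ) * (1 - pgf (P n) (X n) s (Finset.Ioc 0 (r n)))) atTop
      (𝓝 c') := by
  have h1 := h.sub (tendsto_pgf_sub_exp hX h0 hr hs)
  simp only [sub_sub_cancel, sub_zero] at h1
  have h2 := (h1.log (Real.exp_pos _).ne').neg
  simpa using h2

end Array

/-! ### Generating functions determine convergence on `ℕ` -/

theorem integrable_pow (ν : Measure ℕ) [IsProbabilityMeasure ν] {s : ℝ}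
    (hs : s ∈ Set.Icc (0 : ℝ) 1) : Integrable (fun j : ℕ => s ^ j) ν := by
  refine Integrable.of_bound Measurable.of_discrete.aestronglyMeasurable 1 (.of_forall fun j => ?_)
  rw [Real.norm_of_nonneg (pow_nonneg hs.1 _)]
  exact pow_le_one₀ hs.1 hs.2

/-- Truncation error of a probability generating function. -/
theorem abs_integral_pow_sub_sum_le (ν : Measure ℕ) [IsProbabilityMeasure ν] {s : ℝ}
    (hs : s ∈ Set.Icc (0 : ℝ) 1) (k : ℕ) :
    |∫ j, s ^ j ∂ν - ∑ i ∈ Finset.range k, s ^ i * ν.real {i}| ≤ s ^ k := by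
  have hi (i : ℕ) : Integrable (fun j => s ^ i * ({i} : Set ℕ).indicator (1 : ℕ → ℝ) j) ν :=
    ((integrable_const (1 : ℝ)).indicator (measurableSet_singleton i)).const_mul _
  have hsum : ∑ i ∈ Finset.range k, s ^ i * ν.real {i} =
      ∫ j, ∑ i ∈ Finset.range k, s ^ i * ({i} : Set ℕ).indicator (1 : ℕ → ℝ) j ∂ν := by
    rw [integral_finsetSum _ fun i _ => hi i]
    refine Finset.sum_congr rfl fun i _ => ?_
    rw [integral_const_mul, integral_indicator_one (measurableSet_singleton i)]
  rw [hsum, ← integral_sub (integrable_pow ν hs) (integrable_finsetSum _ fun i _ => hi i)]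
  have := norm_integral_le_of_norm_le_const (μ := ν) (C := s ^ k) (f := fun j : ℕ =>
    s ^ j - ∑ i ∈ Finset.range k, s ^ i * ({i} : Set ℕ).indicator (1 : ℕ → ℝ) j)
    (.of_forall fun j => ?_)
  · simpa using this
  · have e : ∑ i ∈ Finset.range k, s ^ i * ({i} : Set ℕ).indicator (1 : ℕ → ℝ) j =
        if j < k then s ^ j else 0 := by
      simp [Set.indicator_apply]
    rw [e]
    split_ifs with h
    · simpa using pow_nonneg hs.1 k
    · rw [sub_zero, Real.norm_of_nonneg (pow_nonneg hs.1 _)]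
      exact pow_le_pow_of_le_one hs.1 hs.2 (not_lt.1 h)

theorem tendsto_real_singleton_of_tendsto_integral_pow {ν : ℕ → Measure ℕ} {ν' : Measure ℕ}
    [∀ n, IsProbabilityMeasure (ν n)] [IsProbabilityMeasure ν']
    (h : ∀ s ∈ Set.Ioo (0 : ℝ) 1,
      Tendsto (fun n => ∫ j, s ^ j ∂(ν n)) atTop (𝓝 (∫ j, s ^ j ∂ν'))) (k : ℕ) :
    Tendsto (fun n => (ν n).real {k}) atTop (𝓝 (ν'.real {k})) := by
  induction k using Nat.strong_induction_on with
  | _ k ih =>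
    refine Metric.tendsto_atTop'.2 fun ε hε => ?_
    -- The tail beyond `k` contributes `O(s ^ (k + 1))`, hence `O(s)` after division by `s ^ k`.
    obtain ⟨s, hs0, hs⟩ : ∃ s : ℝ, 0 < s ∧ s < min (ε / 4) 1 :=
      exists_between (by positivity)
    have hs1 : s < 1 := hs.trans_le (min_le_right _ _)
    have hsε : s < ε / 4 := hs.trans_le (min_le_left _ _)
    have hsI : s ∈ Set.Icc (0 : ℝ) 1 := ⟨hs0.le, hs1.le⟩
    have he := (h s ⟨hs0, hs1⟩).sub (tendsto_finsetSum (Finset.range k)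
      fun i hi => (ih i (Finset.mem_range.1 hi)).const_mul (s ^ i))
    obtain ⟨n₀, hn₀⟩ := Metric.tendsto_atTop'.1 he (s ^ k * (ε / 4)) (by positivity)
    refine ⟨n₀, fun n hn => ?_⟩
    have h1 := hn₀ n hn
    have h2 := abs_integral_pow_sub_sum_le (ν n) hsI (k + 1)
    have h3 := abs_integral_pow_sub_sum_le ν' hsI (k + 1)
    rw [Finset.sum_range_succ, pow_succ, abs_le] at h2 h3
    rw [Real.dist_eq, abs_lt] at h1 ⊢
    have hp : 0 < s ^ k := by positivity
    have h4 : s ^ k * s < s ^ k * (ε / 4) := mul_lt_mul_of_pos_left hsε hp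
    have h5 : 0 < s ^ k * (ε / 4) := by positivity
    constructor
    · refine lt_of_mul_lt_mul_left ?_ hp.le
      linarith
    · refine lt_of_mul_lt_mul_left ?_ hp.le
      linarith

/-- Pointwise convergence of the point masses of probability measures on `ℕ` implies weak
convergence, by Fatou's lemma for the counting measure and the portmanteau theorem. -/
theorem tendsto_of_tendsto_real_singleton {ν : ℕ → ProbabilityMeasure ℕ}
    {ν' : ProbabilityMeasure ℕ}
    (h : ∀ k, Tendsto (fun n => (ν n : Measure ℕ).real {k}) atTop
      (𝓝 ((ν' : Measure ℕ).real {k}))) : Tendsto ν atTop (𝓝 ν') := by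
  refine tendsto_of_forall_isOpen_le_liminf' fun G _ => ?_
  have hpt (k : ℕ) : Tendsto (fun n => (ν n : Measure ℕ) {k}) atTop
      (𝓝 ((ν' : Measure ℕ) {k})) :=
    (ENNReal.tendsto_toReal_iff (fun _ => measure_ne_top _ _) (measure_ne_top _ _)).1 (h k)
  have hmass (m : Measure ℕ) : m G = ∫⁻ k, G.indicator (fun k => m {k}) k ∂Measure.count := by
    rw [lintegral_count, Measure.tsum_indicator_apply_singleton _ _ (.of_discrete)]
  rw [hmass]
  simp_rw [hmass (ν _ : Measure ℕ)]
  refine le_trans (lintegral_mono fun k => ?_)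
    (lintegral_liminf_le fun n => Measurable.of_discrete)
  by_cases hk : k ∈ G
  · simp only [Set.indicator_of_mem hk]
    exact (hpt k).liminf_eq.ge
  · simp [Set.indicator_of_notMem hk]

theorem integral_pow_poissonMeasure (lam : ℝ≥0) (s : ℝ) :
    ∫ j, s ^ j ∂(poissonMeasure lam) = Real.exp (-(lam * (1 - s))) := by
  rw [integral_poissonMeasure]
  have h := (NormedSpace.expSeries_div_hasSum_exp ((lam : ℝ) * s)).mul_left (Real.exp (-lam))
  rw [← Real.exp_eq_exp_ℝ, ← Real.exp_add] at h
  rw [show -((lam : ℝ) * (1 - s)) = -lam + lam * s by ring, ← h.tsum_eq]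
  refine tsum_congr fun j => ?_
  rw [smul_eq_mul, mul_pow]
  ring

/-! ### The number of ones -/

/-- The number of ones among the 0-1 variables `Y k`, `k ∈ I`, as a natural number. -/
noncomputable def onesCount {Ω : Type*} (Y : ℕ → Ω → ℝ) (I : Finset ℕ) (ω : Ω) : ℕ :=
  ∑ k ∈ I, ⌊Y k ω⌋₊

section Row

set_option linter.unusedSectionVars false

variable {Ω : Type*} [mΩ : MeasurableSpace Ω] {P : Measure Ω} [IsProbabilityMeasure P] {n r : ℕ}
  {Y : ℕ → Ω → ℝ} {s : ℝ} {I : Finset ℕ}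

theorem IsStationaryZeroOneRow.measurable_onesCount (hY : IsStationaryZeroOneRow P n Y)
    (hI : I ⊆ Finset.Icc 1 n) : Measurable (onesCount Y I) :=
  Finset.measurable_sum _ fun k hk => Nat.measurable_floor.comp (hY.measurable k (hI hk))

theorem IsStationaryZeroOneRow.thinProd_eq_pow (hY : IsStationaryZeroOneRow P n Y)
    (hI : I ⊆ Finset.Icc 1 n) (ω : Ω) : thinProd s Y I ω = s ^ onesCount Y I ω := by
  rw [onesCount, ← Finset.prod_pow_eq_pow_sum]
  refine Finset.prod_congr rfl fun k hk => ?_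
  rcases hY.zero_or_one k (hI hk) ω with h | h <;> simp [h]

theorem IsStationaryZeroOneRow.partialSum_eq (hY : IsStationaryZeroOneRow P n Y) (hr : r ≤ n)
    (ω : Ω) : partialSum Y r ω = onesCount Y (Finset.Icc 1 r) ω := by
  rw [partialSum, onesCount, Nat.cast_sum]
  refine Finset.sum_congr rfl fun k hk => ?_
  rcases hY.zero_or_one k (Finset.Icc_subset_Icc_right hr hk) ω with h | h <;> simp [h]

theorem IsStationaryZeroOneRow.pgf_eq_integral_map (hY : IsStationaryZeroOneRow P n Y)
    (hI : I ⊆ Finset.Icc 1 n) : pgf P Y s I = ∫ j, s ^ j ∂(P.map (onesCount Y I)) := by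
  rw [integral_map (hY.measurable_onesCount hI).aemeasurable
    Measurable.of_discrete.aestronglyMeasurable]
  simp only [pgf, hY.thinProd_eq_pow hI]

theorem IsStationaryZeroOneRow.real_pos_eq (hY : IsStationaryZeroOneRow P n Y) (hr : r ≤ n) :
    P.real {ω | 0 < partialSum Y r ω} = 1 - pgf P Y 0 (Finset.Icc 1 r) := by
  have hI := Finset.Icc_subset_Icc_right (a := 1) hr
  have hm : MeasurableSet {ω | 0 < partialSum Y r ω} := by
    simp only [hY.partialSum_eq hr, Nat.cast_pos]
    exact measurableSet_lt measurable_const (hY.measurable_onesCount hI)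
  have e : pgf P Y 0 (Finset.Icc 1 r) =
      ∫ ω, {ω | 0 < partialSum Y r ω}ᶜ.indicator 1 ω ∂P := by
    refine integral_congr_ae (.of_forall fun ω => ?_)
    simp [hY.thinProd_eq_pow hI, hY.partialSum_eq hr, Set.indicator_apply, zero_pow_eq]
  rw [e, integral_indicator_one hm.compl, probReal_compl_eq_one_sub hm, sub_sub_cancel]

theorem IsStationaryZeroOneRow.measurableSet_two_le (hY : IsStationaryZeroOneRow P n Y)
    (hI : I ⊆ Finset.Icc 1 n) : MeasurableSet {ω | 2 ≤ onesCount Y I ω} :=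
  measurableSet_le measurable_const (hY.measurable_onesCount hI)

/-- Strict convexity of `1 - s ^ k` at `s = 1 / 2`: values `k ≥ 2` are detected by the generating
function. -/
theorem IsStationaryZeroOneRow.real_two_le_le (hY : IsStationaryZeroOneRow P n Y)
    (hI : I ⊆ Finset.Icc 1 n) :
    1 / 4 * P.real {ω | 2 ≤ onesCount Y I ω} ≤
      (1 - pgf P Y (1 / 2) I) - 1 / 2 * (1 - pgf P Y 0 I) := by
  have hhalf : (1 / 2 : ℝ) ∈ Set.Icc (0 : ℝ) 1 := by norm_num
  have i0 := hY.integrable_thinProd (s := 0) (by simp) hI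
  have i1 := hY.integrable_thinProd hhalf hI
  have hm := hY.measurableSet_two_le hI
  have h : ∫ ω, 1 / 4 * {ω | 2 ≤ onesCount Y I ω}.indicator (1 : Ω → ℝ) ω ∂P ≤
      ∫ ω, ((1 - thinProd (1 / 2) Y I ω) - 1 / 2 * (1 - thinProd 0 Y I ω)) ∂P := by
    refine integral_mono (((integrable_const (1 : ℝ)).indicator hm).const_mul _)
      (((integrable_const (1 : ℝ)).sub i1).sub (((integrable_const (1 : ℝ)).sub i0).const_mul _))
      fun ω => ?_
    simp only [hY.thinProd_eq_pow hI, Set.indicator_apply, Set.mem_ofPred_eq, Pi.one_apply]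
    rcases hk : onesCount Y I ω with _ | _ | k
    · simp
    · norm_num
    · have : (1 / 2 : ℝ) ^ k ≤ 1 := pow_le_one₀ (by norm_num) (by norm_num)
      rw [if_pos (by omega), zero_pow (by omega), pow_succ, pow_succ]
      linarith
  rw [integral_const_mul, integral_indicator_one hm] at h
  refine h.trans (le_of_eq ?_)
  rw [integral_sub (by exact (integrable_const (1 : ℝ)).sub i1)
    (by exact ((integrable_const (1 : ℝ)).sub i0).const_mul _), integral_const_mul,
    integral_sub (integrable_const _) i1, integral_sub (integrable_const _) i0]
  simp [pgf]

/-- If ones come one at a time, up to an event of small probability, then the generating function is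
close to that of an indicator. -/
theorem IsStationaryZeroOneRow.abs_one_sub_pgf_sub_le (hY : IsStationaryZeroOneRow P n Y)
    (hs : s ∈ Set.Icc (0 : ℝ) 1) (hI : I ⊆ Finset.Icc 1 n) :
    |(1 - pgf P Y s I) - (1 - s) * (1 - pgf P Y 0 I)| ≤ P.real {ω | 2 ≤ onesCount Y I ω} := by
  have i0 := hY.integrable_thinProd (s := 0) (by simp) hI
  have i1 := hY.integrable_thinProd hs hI
  have hm := hY.measurableSet_two_le hI
  have e : (1 - pgf P Y s I) - (1 - s) * (1 - pgf P Y 0 I) =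
      ∫ ω, ((1 - thinProd s Y I ω) - (1 - s) * (1 - thinProd 0 Y I ω)) ∂P := by
    rw [integral_sub (by exact (integrable_const (1 : ℝ)).sub i1)
      (by exact ((integrable_const (1 : ℝ)).sub i0).const_mul _), integral_const_mul,
      integral_sub (integrable_const (1 : ℝ)) i1, integral_sub (integrable_const (1 : ℝ)) i0]
    simp [pgf]
  rw [e, ← integral_indicator_one hm, ← Real.norm_eq_abs]
  refine norm_integral_le_of_norm_le (μ := P) ((integrable_const (1 : ℝ)).indicator hm)
    (.of_forall fun ω => ?_)
  simp only [hY.thinProd_eq_pow hI, Set.indicator_apply, Set.mem_ofPred_eq, Pi.one_apply]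
  rcases hk : onesCount Y I ω with _ | _ | k
  · simp
  · simp
  · have h1 : s ^ (k + 2) ≤ s := pow_le_of_le_one hs.1 hs.2 (by omega)
    have h2 : 0 ≤ s ^ (k + 2) := pow_nonneg hs.1 _
    rw [if_pos (by omega), zero_pow (by omega), Real.norm_eq_abs, abs_le]
    constructor <;> linarith [hs.1, hs.2]

theorem IsStationaryZeroOneRow.clusterSizeLaw_apply (hY : IsStationaryZeroOneRow P n Y)
    (hr : r ≤ n) {E : Set ℝ} (hE : MeasurableSet E) :
    clusterSizeLaw P Y r E = (P {ω | 0 < partialSum Y r ω})⁻¹ *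
      P {ω | 0 < onesCount Y (Finset.Icc 1 r) ω ∧
        (onesCount Y (Finset.Icc 1 r) ω : ℝ) ∈ E} := by
  have hI := Finset.Icc_subset_Icc_right (a := 1) hr
  have hS : Measurable (partialSum Y r) := by
    rw [show partialSum Y r = fun ω => (onesCount Y (Finset.Icc 1 r) ω : ℝ) from
      funext (hY.partialSum_eq hr)]
    exact Measurable.of_discrete.comp (hY.measurable_onesCount hI)
  rw [clusterSizeLaw, Measure.map_apply hS hE,
    cond_apply (measurableSet_lt measurable_const hS)]
  congr 2
  ext ω
  simp [hY.partialSum_eq hr]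

theorem IsStationaryZeroOneRow.clusterSizeLaw_mono (hY : IsStationaryZeroOneRow P n Y)
    (hr : r ≤ n) {ε : ℝ} (hε : 0 < ε) :
    clusterSizeLaw P Y r {x | ε ≤ |x - 1|} ≤ clusterSizeLaw P Y r {x | 1 ≤ |x - 1|} := by
  have hE (δ : ℝ) : MeasurableSet {x : ℝ | δ ≤ |x - 1|} :=
    measurableSet_le measurable_const (by fun_prop)
  rw [hY.clusterSizeLaw_apply hr (hE _), hY.clusterSizeLaw_apply hr (hE _)]
  refine mul_le_mul_right (measure_mono ?_) _
  rintro ω ⟨h0, h1⟩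
  refine ⟨h0, ?_⟩
  simp only [Set.mem_ofPred_eq] at h1 ⊢
  rcases h : onesCount Y (Finset.Icc 1 r) ω with _ | _ | k
  · omega
  · simp [h] at h1; linarith
  · push_cast
    rw [abs_of_nonneg] <;> linarith [Nat.cast_nonneg (α := ℝ) k]

theorem IsStationaryZeroOneRow.toReal_clusterSizeLaw (hY : IsStationaryZeroOneRow P n Y)
    (hr : r ≤ n) :
    (clusterSizeLaw P Y r {x | 1 ≤ |x - 1|}).toReal =
      P.real {ω | 2 ≤ onesCount Y (Finset.Icc 1 r) ω} / (1 - pgf P Y 0 (Finset.Icc 1 r)) := by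
  have hE : MeasurableSet {x : ℝ | 1 ≤ |x - 1|} :=
    measurableSet_le measurable_const (by fun_prop)
  rw [hY.clusterSizeLaw_apply hr hE, ENNReal.toReal_mul, ENNReal.toReal_inv, ← hY.real_pos_eq hr,
    div_eq_inv_mul]
  simp only [measureReal_def]
  congr 3
  ext ω
  simp only [Set.mem_ofPred_eq]
  rcases onesCount Y (Finset.Icc 1 r) ω with _ | _ | k
  · simp
  · simp
  · simp only [Nat.cast_add, Nat.cast_one]
    refine ⟨fun _ => by omega, fun _ => ⟨by omega, ?_⟩⟩
    rw [abs_of_nonneg] <;> linarith [Nat.cast_nonneg (α := ℝ) k]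

end Row

theorem Ioc_zero_eq_Icc_one (n : ℕ) : Finset.Ioc 0 n = Finset.Icc 1 n := by
  ext k; simp only [Finset.mem_Ioc, Finset.mem_Icc]; omega

/-! ### The Poisson limit -/

section Array

variable {Ω : ℕ → Type*} [∀ n, MeasurableSpace (Ω n)] {P : ∀ n, Measure (Ω n)}
  [∀ n, IsProbabilityMeasure (P n)] {X : ∀ n, ℕ → Ω n → ℝ} {r : ℕ → ℕ} {lam : ℝ≥0}

theorem tendsto_pgf_of_tendstoInDistribution
    (hX : ∀ n, IsStationaryZeroOneRow (P n) n (X n))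
    (h : TendstoInDistribution (fun n => partialSum (X n) n) atTop
      (fun k : ℕ => (k : ℝ)) P (poissonMeasure lam))
    {s : ℝ} (f : BoundedContinuousFunction ℝ ℝ) (hf : ∀ k : ℕ, f k = s ^ k) :
    Tendsto (fun n => pgf (P n) (X n) s (Finset.Icc 1 n)) atTop
      (𝓝 (Real.exp (-(lam * (1 - s))))) := by
  have h1 := ProbabilityMeasure.tendsto_iff_forall_integral_tendsto.1 h.tendsto f
  simp only [ProbabilityMeasure.coe_mk] at h1
  rw [integral_map h.aemeasurable_limit f.continuous.aestronglyMeasurable] at h1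
  simp only [hf, integral_pow_poissonMeasure] at h1
  refine h1.congr fun n => ?_
  rw [integral_map (h.forall_aemeasurable n) f.continuous.aestronglyMeasurable]
  simp only [(hX n).partialSum_eq le_rfl, hf, pgf, (hX n).thinProd_eq_pow subset_rfl]

/-- The tent function and `2 ^ (-|x|)` are bounded continuous test functions that extend `k ↦ s ^ k`
for `s = 0` and `s = 1 / 2`. -/
theorem exists_boundedContinuous_eq_pow :
    (∃ f : BoundedContinuousFunction ℝ ℝ, ∀ k : ℕ, f k = (0 : ℝ) ^ k) ∧
      ∃ f : BoundedContinuousFunction ℝ ℝ, ∀ k : ℕ, f k = (1 / 2 : ℝ) ^ k := by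
  constructor
  · refine ⟨BoundedContinuousFunction.ofNormedAddCommGroup (fun x : ℝ => max 0 (1 - |x|))
      (by fun_prop) 1 fun x => ?_, fun k => ?_⟩
    · rw [Real.norm_of_nonneg (le_max_left _ _)]
      exact max_le zero_le_one (by linarith [abs_nonneg x])
    · rcases k with _ | k
      · simp
      · simp only [BoundedContinuousFunction.coe_ofNormedAddCommGroup, Nat.abs_cast]
        rw [zero_pow (by omega)]
        push_cast
        exact max_eq_left (by linarith [Nat.cast_nonneg (α := ℝ) k])
  · refine ⟨BoundedContinuousFunction.ofNormedAddCommGroup (fun x : ℝ => (1 / 2 : ℝ) ^ |x|)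
      ?_ 1 fun x => ?_, fun k => ?_⟩
    · exact continuous_const.rpow continuous_abs fun x => .inl (by norm_num)
    · rw [Real.norm_of_nonneg (by positivity)]
      exact Real.rpow_le_one (by norm_num) (by norm_num) (abs_nonneg x)
    · simp only [BoundedContinuousFunction.coe_ofNormedAddCommGroup, Nat.abs_cast]
      exact Real.rpow_natCast _ _

/-- A Poisson limit with rate `λ` forces `N q → λ` for the probability `q` of a nonempty block and
`N (1 - g) → λ / 2` for its generating function `g` at `1 / 2`, which leaves only `o(q)` for
blocks with two or more ones. -/
theorem clusterSizeLaw_tendsto_of_poisson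
    (hX : ∀ n, IsStationaryZeroOneRow (P n) n (X n)) (hlam : 0 < lam)
    (h : TendstoInDistribution (fun n => partialSum (X n) n) atTop
      (fun k : ℕ => (k : ℝ)) P (poissonMeasure lam)) (hr : r ∈ classR P X) :
    (∀ᶠ n in atTop, 0 < P n {ω | 0 < partialSum (X n) (r n) ω}) ∧
      LawsTendstoInProbability (fun n => clusterSizeLaw (P n) (X n) (r n)) 1 := by
  obtain ⟨⟨f₀, hf₀⟩, f₁, hf₁⟩ := exists_boundedContinuous_eq_pow
  have g0 := tendsto_pgf_of_tendstoInDistribution hX h f₀ hf₀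
  have g1 := tendsto_pgf_of_tendstoInDistribution hX h f₁ hf₁
  simp only [← Ioc_zero_eq_Icc_one] at g0 g1
  have n0 := tendsto_mul_one_sub_pgf hX g0 hr (by simp) g0
  have n1 := tendsto_mul_one_sub_pgf hX g0 hr (by norm_num) g1
  simp only [Ioc_zero_eq_Icc_one] at n0 n1
  have hlam' : (0 : ℝ) < lam := by exact_mod_cast hlam
  obtain ⟨-, -, hrn, -⟩ := exists_gap_of_mem_classR hr
  have hrn : ∀ᶠ n in atTop, r n ≤ n := by simpa using hrn 1
  have hpos := n0.eventually (lt_mem_nhds (show (0 : ℝ) < lam * (1 - 0) by simpa using hlam'))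
  have hq : ∀ᶠ n in atTop, 0 < P n {ω | 0 < partialSum (X n) (r n) ω} := by
    filter_upwards [hpos, hrn] with n h1 h2
    rw [← (hX n).real_pos_eq h2] at h1
    exact (ENNReal.toReal_pos_iff.1 (pos_of_mul_pos_right h1 (Nat.cast_nonneg _))).1
  refine ⟨hq, fun ε hε => ?_⟩
  have hp2 : Tendsto (fun n => ((n / r n : ℕ) : ℝ) *
      (P n).real {ω | 2 ≤ onesCount (X n) (Finset.Icc 1 (r n)) ω}) atTop (𝓝 0) := by
    have hlim := (n1.sub (n0.const_mul (1 / 2))).const_mul 4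
    rw [show 4 * ((lam : ℝ) * (1 - 1 / 2) - 1 / 2 * (lam * (1 - 0))) = 0 by ring] at hlim
    refine squeeze_zero' (.of_forall fun n => by positivity) ?_ hlim
    filter_upwards [hrn] with n h2
    have := (hX n).real_two_le_le (Finset.Icc_subset_Icc_right (a := 1) h2)
    have := mul_le_mul_of_nonneg_left this (Nat.cast_nonneg (α := ℝ) (n / r n))
    linarith
  have hratio := hp2.div n0 (by simpa using hlam'.ne')
  rw [zero_div] at hratio
  have hreal : Tendsto (fun n =>
      (clusterSizeLaw (P n) (X n) (r n) {x | 1 ≤ |x - 1|}).toReal) atTop (𝓝 0) := by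
    refine hratio.congr' ?_
    filter_upwards [hpos, hrn] with n h1 h2
    rw [(hX n).toReal_clusterSizeLaw h2, Pi.div_apply, mul_div_mul_left]
    rintro h0
    simp [h0] at h1
  have hfin (n : ℕ) : clusterSizeLaw (P n) (X n) (r n) {x | 1 ≤ |x - 1|} ≠ ∞ := by
    unfold clusterSizeLaw
    exact measure_ne_top _ _
  have henn := (ENNReal.tendsto_toReal_iff hfin ENNReal.zero_ne_top).1 (by simpa using hreal)
  refine tendsto_of_tendsto_of_tendsto_of_le_of_le' tendsto_const_nhds henn
    (.of_forall fun n => zero_le) ?_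
  filter_upwards [hrn] with n h2
  exact (hX n).clusterSizeLaw_mono h2 hε

theorem tendstoInDistribution_poisson_of_tendsto_pgf
    (hX : ∀ n, IsStationaryZeroOneRow (P n) n (X n))
    (h : ∀ s ∈ Set.Ioo (0 : ℝ) 1, Tendsto (fun n => pgf (P n) (X n) s (Finset.Icc 1 n)) atTop
      (𝓝 (Real.exp (-(lam * (1 - s)))))) :
    TendstoInDistribution (fun n => partialSum (X n) n) atTop
      (fun k : ℕ => (k : ℝ)) P (poissonMeasure lam) := by
  have hm (n : ℕ) : AEMeasurable (onesCount (X n) (Finset.Icc 1 n)) (P n) :=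
    ((hX n).measurable_onesCount subset_rfl).aemeasurable
  have hprob (n : ℕ) : IsProbabilityMeasure ((P n).map (onesCount (X n) (Finset.Icc 1 n))) :=
    Measure.isProbabilityMeasure_map (hm n)
  have hN : TendstoInDistribution (fun n => onesCount (X n) (Finset.Icc 1 n)) atTop
      (id : ℕ → ℕ) P (poissonMeasure lam) := by
    refine ⟨hm, aemeasurable_id, tendsto_of_tendsto_real_singleton ?_⟩
    simp only [ProbabilityMeasure.coe_mk, Measure.map_id]
    refine tendsto_real_singleton_of_tendsto_integral_pow fun s hs => ?_
    rw [integral_pow_poissonMeasure]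
    simpa only [(hX _).pgf_eq_integral_map subset_rfl] using h s hs
  have hR := hN.continuous_comp (g := fun k : ℕ => (k : ℝ)) continuous_of_discreteTopology
  have e : (fun n => partialSum (X n) n) =
      fun n => (fun k : ℕ => (k : ℝ)) ∘ onesCount (X n) (Finset.Icc 1 n) :=
    funext fun n => funext fun ω => (hX n).partialSum_eq le_rfl ω
  rw [e]
  exact hR

/-- If blocks with two or more ones are negligible among nonempty blocks, then `N (1 - g)` and
`(1 - s) N q` have the same limit, so that the generating function of `S_n` is asymptotically that
of the Poisson law. -/
theorem tendstoInDistribution_poisson_of_clusterSizeLaw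
    (hX : ∀ n, IsStationaryZeroOneRow (P n) n (X n))
    (h0 : Tendsto (fun n => pgf (P n) (X n) 0 (Finset.Icc 1 n)) atTop
      (𝓝 (Real.exp (-(lam : ℝ))))) (hlam : 0 < lam) (hr : r ∈ classR P X)
    (hc : LawsTendstoInProbability (fun n => clusterSizeLaw (P n) (X n) (r n)) 1) :
    TendstoInDistribution (fun n => partialSum (X n) n) atTop
      (fun k : ℕ => (k : ℝ)) P (poissonMeasure lam) := by
  refine tendstoInDistribution_poisson_of_tendsto_pgf hX fun s hs => ?_
  have hsI : s ∈ Set.Icc (0 : ℝ) 1 := Set.Ioo_subset_Icc_self hs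
  have hlam' : (0 : ℝ) < lam := by exact_mod_cast hlam
  simp only [← Ioc_zero_eq_Icc_one] at h0 ⊢
  have n0 := tendsto_mul_one_sub_pgf hX h0 hr (by simp) h0
  have key := tendsto_pgf_sub_exp hX h0 hr hsI
  simp only [Ioc_zero_eq_Icc_one] at n0 key ⊢
  obtain ⟨-, -, hrn, -⟩ := exists_gap_of_mem_classR hr
  have hrn : ∀ᶠ n in atTop, r n ≤ n := by simpa using hrn 1
  have hreal : Tendsto (fun n =>
      (clusterSizeLaw (P n) (X n) (r n) {x | 1 ≤ |x - 1|}).toReal) atTop (𝓝 0) := by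
    simpa [Function.comp_def] using
      (ENNReal.tendsto_toReal ENNReal.zero_ne_top).comp (hc 1 one_pos)
  have hp2 : Tendsto (fun n => ((n / r n : ℕ) : ℝ) *
      (P n).real {ω | 2 ≤ onesCount (X n) (Finset.Icc 1 (r n)) ω}) atTop (𝓝 0) := by
    have hmul := n0.mul hreal
    rw [mul_zero] at hmul
    refine hmul.congr' ?_
    filter_upwards [n0.eventually (lt_mem_nhds hlam'), hrn] with n h1 h2
    rw [(hX n).toReal_clusterSizeLaw h2, mul_assoc, mul_div_cancel₀]
    rintro hq
    simp [hq] at h1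
  have hs' : Tendsto (fun n => ((n / r n : ℕ) : ℝ) *
      (1 - pgf (P n) (X n) s (Finset.Icc 1 (r n)))) atTop (𝓝 (lam * (1 - s))) := by
    have hdiff : Tendsto (fun n => ((n / r n : ℕ) : ℝ) *
        (1 - pgf (P n) (X n) s (Finset.Icc 1 (r n))) - (1 - s) * (((n / r n : ℕ) : ℝ) *
          (1 - pgf (P n) (X n) 0 (Finset.Icc 1 (r n))))) atTop (𝓝 0) := by
      refine squeeze_zero_norm' ?_ hp2
      filter_upwards [hrn] with n h2
      have := (hX n).abs_one_sub_pgf_sub_le hsI (Finset.Icc_subset_Icc_right (a := 1) h2)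
      have := mul_le_mul_of_nonneg_left this (Nat.cast_nonneg (α := ℝ) (n / r n))
      refine le_trans (le_of_eq ?_) this
      rw [← abs_of_nonneg (Nat.cast_nonneg (α := ℝ) (n / r n)), ← abs_mul, Real.norm_eq_abs,
        abs_of_nonneg (Nat.cast_nonneg (α := ℝ) (n / r n))]
      congr 1
      ring
    have := hdiff.add (n0.const_mul (1 - s))
    simp only [sub_add_cancel, zero_add] at this
    rwa [mul_comm (1 - s)] at this
  have := key.add ((Real.continuous_exp.tendsto _).comp hs'.neg)
  simp only [Function.comp_def, sub_add_cancel, zero_add] at this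
  exact this

end Array

end PoissonArray

theorem theorem3 {Ω : ℕ → Type*} [∀ n, MeasurableSpace (Ω n)]
    (P : ∀ n, Measure (Ω n)) [∀ n, IsProbabilityMeasure (P n)]
    (X : ∀ n, ℕ → Ω n → ℝ)
    (hX : ∀ n, PoissonArray.IsStationaryZeroOneRow (P n) n (X n))
    (hΔ : PoissonArray.ConditionDelta P X)
    (lam : ℝ≥0) (hlam : 0 < lam) :
    (TendstoInDistribution (fun n => PoissonArray.partialSum (X n) n) atTop
        (fun k : ℕ => (k : ℝ)) P (poissonMeasure lam) →
      ∀ r ∈ PoissonArray.classR P X,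
        (∀ᶠ n in atTop, 0 < P n {ω | 0 < PoissonArray.partialSum (X n) (r n) ω}) ∧
        PoissonArray.LawsTendstoInProbability
          (fun n => PoissonArray.clusterSizeLaw (P n) (X n) (r n)) 1) ∧
    (Tendsto (fun n => (P n).real {ω | ∀ k ∈ Finset.Icc 1 n, X n k ω = 0}) atTop
        (𝓝 (Real.exp (-(lam : ℝ)))) →
      (∃ r ∈ PoissonArray.classR P X,
        PoissonArray.LawsTendstoInProbability
          (fun n => PoissonArray.clusterSizeLaw (P n) (X n) (r n)) 1) →
      TendstoInDistribution (fun n => PoissonArray.partialSum (X n) n) atTop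
        (fun k : ℕ => (k : ℝ)) P (poissonMeasure lam)) := by
  refine ⟨fun h r hr => PoissonArray.clusterSizeLaw_tendsto_of_poisson hX hlam h hr, ?_⟩
  rintro h0 ⟨r, hr, hc⟩
  refine PoissonArray.tendstoInDistribution_poisson_of_clusterSizeLaw hX ?_ hlam hr hc
  refine h0.congr fun n => ?_
  rw [(hX n).pgf_eq_sum subset_rfl, Finset.sum_eq_single_of_mem (Finset.Icc 1 n) (by simp)]
  · simp [PoissonArray.thinWeight, PoissonArray.zeroSet]
  · intro T hT hne
    -- At `s = 0` the weight of a proper subset vanishes.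
    have : (Finset.Icc 1 n \ T).card ≠ 0 := by
      rw [Finset.card_ne_zero, Finset.sdiff_nonempty]
      exact fun h => hne (subset_antisymm (Finset.mem_powerset.1 hT) h)
    simp [PoissonArray.thinWeight, zero_pow this]
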